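/- Let $\Lambda^-=\mathbb C[p_1,p_3,p_5,\dots]$ be the ring generated by the odd power sums, and define the operators $Y_n$ ($n\in\mathbb Z$) on $\Lambda^-$ by $$Y(t)=\sum_{n\in\mathbb Z}Y_n t^{-n}=\exp\Bigl(\sum_{k\ge 1}\frac{2\,t^{2k-1}}{2k-1}\,p_{2k-1}\Bigr)\exp\Bigl(-\sum_{k\ge 1}t^{-(2k-1)}\frac{\partial}{\partial p_{2k-1}}\Bigr).$$ For a finite sequence $\mu=(\mu_1,\dots,\mu_l)$ of nonnegative integers write $Y_{-\mu}=Y_{-\mu_1}Y_{-\mu_2}\cdots Y_{-\mu_l}$ (the identity if $l=0$). Let $\mu$ be a composition of $m$, that is, a finite sequence of nonnegative integers with sum $m$, at most one of which is zero. Then either $Y_{-\mu}=0$, or there is a strict partition $\lambda$ of $m$ of the same length as $\mu$ (nonnegative integers $\lambda_1>\lambda_2>\cdots>\lambda_l$ with sum $m$) such that $Y_{-\mu}=Y_{-\lambda}$ or $Y_{-\mu}=-Y_{-\lambda}$; moreover $\lambda$ can be chosen with all parts positive if all parts of $\mu$ are positive. -/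

import Mathlib

open scoped Nat

noncomputable section

namespace SchurQ

/-- The ring `Λ⁻ = ℂ[p₁, p₃, p₅, …]` generated by the (algebraically independent) power sums of
odd degree; the variable with index `k` is the power sum `p_k`, of degree `k`. -/
abbrev OddSym : Type := MvPolynomial {k : ℕ // Odd k} ℂ

/-- The formal exponential `exp A = ∑ₙ Aⁿ / n!` of a power series `A = A(t)` with zero constant
term, over a (not necessarily commutative) `ℂ`-algebra.  Only the terms with `n ≤ r` contribute
to the coefficient of `t ^ r`, see `coeff_pow_eq_zero`. -/
def formalExp {R : Type*} [Ring R] [Algebra ℂ R] (A : PowerSeries R) : PowerSeries R :=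
  PowerSeries.mk fun r => ∑ n ∈ Finset.range (r + 1), ((n ! : ℂ)⁻¹) • PowerSeries.coeff r (A ^ n)

theorem coeff_pow_eq_zero {R : Type*} [Ring R] (A : PowerSeries R)
    (hA : PowerSeries.coeff 0 A = 0) (n r : ℕ) (h : r < n) :
    PowerSeries.coeff r (A ^ n) = 0 := by
  induction n generalizing r with
  | zero => omega
  | succ n ih =>
    rw [pow_succ, PowerSeries.coeff_mul]
    refine Finset.sum_eq_zero fun x hx => ?_
    have hx' := Finset.HasAntidiagonal.mem_antidiagonal.mp hx
    by_cases h2 : x.2 = 0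
    · rw [h2, hA, mul_zero]
    · rw [ih x.1 (by omega), zero_mul]

/-- `∑_{m odd} (2 / m) p_m t ^ m`. -/
def creationExponent : PowerSeries OddSym :=
  PowerSeries.mk fun m =>
    if h : Odd m then MvPolynomial.C (2 / (m : ℂ)) * MvPolynomial.X ⟨m, h⟩ else 0

/-- `- ∑_{m odd} u ^ m ∂/∂p_m`, where `u` stands for `t⁻¹`. -/
def annihilationExponent : PowerSeries (Module.End ℂ OddSym) :=
  PowerSeries.mk fun m =>
    if h : Odd m then -(MvPolynomial.pderiv (R := ℂ) (⟨m, h⟩ : {k : ℕ // Odd k})).toLinearMap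
    else 0

/-- The coefficient of `t ^ r` in `exp (∑_{m odd} (2 / m) p_m t ^ m)`; it is `0` for `r < 0`. -/
def creationCoeff (r : ℤ) : OddSym :=
  if 0 ≤ r then PowerSeries.coeff r.toNat (formalExp creationExponent) else 0

/-- The coefficient of `t ^ (-s)` in `exp (- ∑_{m odd} t ^ (-m) ∂/∂p_m)`. -/
def annihilationCoeff (s : ℕ) : Module.End ℂ OddSym :=
  PowerSeries.coeff s (formalExp annihilationExponent)

/-- The degree of a monomial, where `p_k` has degree `k`. -/
def wt (e : {k : ℕ // Odd k} →₀ ℕ) : ℕ := e.sum fun k a => a * (k : ℕ)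

theorem wt_add (e e' : {k : ℕ // Odd k} →₀ ℕ) : wt (e + e') = wt e + wt e' := by
  unfold wt
  exact Finsupp.sum_add_index' (by simp) (by intros; ring)

/-- The polynomials `f` with `deg f + s ≤ d`. -/
def degLE (d s : ℕ) : Submodule ℂ OddSym where
  carrier := {f | ∀ e, MvPolynomial.coeff e f ≠ 0 → wt e + s ≤ d}
  zero_mem' := by intro e he; simp at he
  add_mem' := by
    intro f g hf hg e he
    by_cases h : MvPolynomial.coeff e f = 0
    · refine hg e fun h' => he ?_
      rw [MvPolynomial.coeff_add, h, h', add_zero]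
    · exact hf e h
  smul_mem' := by
    intro c f hf e he
    refine hf e fun h' => he ?_
    rw [MvPolynomial.coeff_smul, h', smul_zero]

theorem annihilationExponent_mem (m d s : ℕ) (f : OddSym) (hf : f ∈ degLE d s) :
    PowerSeries.coeff m annihilationExponent f ∈ degLE d (s + m) := by
  unfold annihilationExponent
  rw [PowerSeries.coeff_mk]
  split_ifs with h
  · rw [LinearMap.neg_apply]
    refine Submodule.neg_mem _ ?_
    intro e he
    have key : MvPolynomial.coeff (e + Finsupp.single ⟨m, h⟩ 1) f ≠ 0 := by
      intro h0
      apply he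
      change MvPolynomial.coeff e (MvPolynomial.pderiv (R := ℂ) ⟨m, h⟩ f) = 0
      rw [MvPolynomial.coeff_pderiv, h0]
      simp
    have := hf _ key
    rw [wt_add] at this
    have h1 : wt (Finsupp.single ⟨m, h⟩ 1) = m := by simp [wt]
    omega
  · simp

theorem annihilationExponent_pow_mem (n m d s : ℕ) (f : OddSym) (hf : f ∈ degLE d s) :
    PowerSeries.coeff m (annihilationExponent ^ n) f ∈ degLE d (s + m) := by
  induction n generalizing m s f with
  | zero =>
    rw [pow_zero, PowerSeries.coeff_one]
    split_ifs with h
    · subst h; simpa using hf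
    · simp
  | succ n ih =>
    rw [pow_succ, PowerSeries.coeff_mul, LinearMap.sum_apply]
    refine Submodule.sum_mem _ fun x hx => ?_
    have hx' := Finset.HasAntidiagonal.mem_antidiagonal.mp hx
    have := ih x.1 (s + x.2) _ (annihilationExponent_mem x.2 d s f hf)
    rw [Module.End.mul_apply]
    have e : s + x.2 + x.1 = s + m := by omega
    rwa [e] at this

/-- On a fixed polynomial only finitely many of the `annihilationCoeff s` act nontrivially. -/
theorem annihilationCoeff_finite (f : OddSym) :
    {s : ℕ | annihilationCoeff s f ≠ 0}.Finite := by
  have hf : f ∈ degLE (f.support.sup wt) 0 := by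
    intro e he
    have := Finset.le_sup (f := wt) (MvPolynomial.mem_support_iff.mpr he)
    omega
  refine (Set.finite_Iic (f.support.sup wt)).subset fun s hs => ?_
  by_contra hlt
  apply hs
  have hmem : annihilationCoeff s f ∈ degLE (f.support.sup wt) (0 + s) := by
    unfold annihilationCoeff formalExp
    rw [PowerSeries.coeff_mk, LinearMap.sum_apply]
    refine Submodule.sum_mem _ fun n _ => ?_
    rw [LinearMap.smul_apply]
    exact Submodule.smul_mem _ _ (annihilationExponent_pow_mem n s _ 0 f hf)
  ext e
  by_contra hne
  have := hmem e (by simpa using hne)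
  simp only [Set.mem_Iic] at hlt
  omega

theorem vertexSummand_finite (n : ℤ) (f : OddSym) :
    (Function.support fun s : ℕ => creationCoeff (s - n) * annihilationCoeff s f).Finite := by
  refine (annihilationCoeff_finite f).subset fun s hs h0 => hs ?_
  change creationCoeff (s - n) * annihilationCoeff s f = 0
  rw [h0, mul_zero]

/-- The operator `Y_n` on `Λ⁻`, for `n : ℤ`, which is the coefficient of `t ^ (-n)` in
`Y(t) = ∑ₙ Y_n t ^ (-n) =
  exp (∑_{m odd} (2 / m) p_m t ^ m) exp (- ∑_{m odd} t ^ (-m) ∂/∂p_m)`.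
The sum is over the pairs of a power `t ^ r` from the first and a power `t ^ (-s)` from the second
factor with `r - s = -n`; it is finite on each `f`. -/
def Y (n : ℤ) : Module.End ℂ OddSym where
  toFun f := ∑ᶠ s : ℕ, creationCoeff (s - n) * annihilationCoeff s f
  map_add' f g := by
    rw [← finsum_add_distrib (vertexSummand_finite n f) (vertexSummand_finite n g)]
    simp only [map_add, mul_add]
  map_smul' c f := by
    simp only [map_smul, mul_smul_comm, RingHom.id_apply]
    rw [smul_finsum' c (vertexSummand_finite n f)]

/-- `Y_{-μ} = Y_{-μ₁} Y_{-μ₂} ⋯ Y_{-μ_l}`, a composite of operators on `Λ⁻`. -/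
def YNeg (μ : List ℕ) : Module.End ℂ OddSym := (μ.map fun a => Y (-(a : ℤ))).prod

/-- `lam = (λ₁, …, λ_l)` is a strict partition of `m`: nonnegative integers with
`λ₁ > λ₂ > ⋯ > λ_l` and sum `m`.  (Thus only the last part may be zero.) -/
def IsStrictPartition (lam : List ℕ) (m : ℕ) : Prop :=
  lam.Pairwise (· > ·) ∧ lam.sum = m

end SchurQ

end

open scoped Nat

noncomputable section

namespace SchurQ

/-! Write q(t) and D(1/t) for the two exponentials in Y(t). Moving D(x) past q(u) costs only the
scalar series (1 - xu)/(1 + xu) (`annihilationCoeff_qPoly_mul`), so Y(t)Y(u) = (t - u)/(t + u)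
q(t)q(u) D(1/t)D(1/u), expanded in powers of u/t (`Y_neg_mul_apply`). The D's commute. Adding the
product in the other order adds the expansion in t/u of the opposite function. The two expansions
sum to a delta series supported at u = -t, where q(t)q(-t) = 1, so after multiplication by q(t)q(u)
only total degree 0 survives (`pairCoeff_add_pairCoeff`).

Since the D's only lower degree, Y_{-a} and Y_{-b} anticommute whenever a + b > 0, and Y_{-a}
squares to 0 for a > 0. With at most one zero entry every transposition is allowed: a repeated entry
kills the product, and distinct entries can be sorted at the cost of a sign. -/

/-! ### Formal exponentials and the Euler operator -/

/-- The Euler operator `t d/dt` on power series over a possibly noncommutative ring. -/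
def euler {R : Type*} [Ring R] (F : PowerSeries R) : PowerSeries R :=
  PowerSeries.mk fun n => n • PowerSeries.coeff n F

@[simp]
theorem coeff_euler {R : Type*} [Ring R] (F : PowerSeries R) (n : ℕ) :
    PowerSeries.coeff n (euler F) = n • PowerSeries.coeff n F := PowerSeries.coeff_mk _ _

theorem euler_mul {R : Type*} [Ring R] (F G : PowerSeries R) :
    euler (F * G) = euler F * G + F * euler G := by
  ext n
  rw [map_add, coeff_euler, PowerSeries.coeff_mul, PowerSeries.coeff_mul, PowerSeries.coeff_mul,
    ← Finset.sum_add_distrib, Finset.smul_sum]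
  refine Finset.sum_congr rfl fun x hx => ?_
  rw [← Finset.HasAntidiagonal.mem_antidiagonal.mp hx, coeff_euler, coeff_euler,
    add_smul, smul_mul_assoc, mul_smul_comm]

theorem euler_pow_succ {R : Type*} [Ring R] (A : PowerSeries R) (hA : Commute A (euler A)) (n : ℕ) :
    euler (A ^ (n + 1)) = (n + 1) • (euler A * A ^ n) := by
  induction n with
  | zero => simp
  | succ n ih =>
    rw [pow_succ' A (n + 1), euler_mul, ih, mul_smul_comm, ← mul_assoc, hA.eq, mul_assoc,
      ← pow_succ', ← succ_nsmul']

theorem commute_of_coeff {R : Type*} [Ring R] {F G : PowerSeries R}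
    (h : ∀ i j, Commute (PowerSeries.coeff i F) (PowerSeries.coeff j G)) : Commute F G := by
  ext n
  rw [PowerSeries.coeff_mul, PowerSeries.coeff_mul, ← Finset.Nat.sum_antidiagonal_swap]
  exact Finset.sum_congr rfl fun x _ => (h _ _).eq

theorem commute_coeff_pow {R : Type*} [Ring R] {A : PowerSeries R} {x : R}
    (h : ∀ i, Commute x (PowerSeries.coeff i A)) (n r : ℕ) :
    Commute x (PowerSeries.coeff r (A ^ n)) := by
  induction n generalizing r with
  | zero =>
    rw [pow_zero, PowerSeries.coeff_one]
    split_ifs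
    · exact Commute.one_right x
    · exact Commute.zero_right x
  | succ n ih =>
    rw [pow_succ, PowerSeries.coeff_mul]
    exact Commute.sum_right _ _ _ fun y _ => (ih _).mul_right (h _)

section formalExp

variable {R : Type*} [Ring R] [Algebra ℂ R]

theorem commute_coeff_formalExp {A : PowerSeries R} {x : R}
    (h : ∀ i, Commute x (PowerSeries.coeff i A)) (r : ℕ) :
    Commute x (PowerSeries.coeff r (formalExp A)) := by
  unfold formalExp
  rw [PowerSeries.coeff_mk]
  exact Commute.sum_right _ _ _ fun n _ => (commute_coeff_pow h n r).smul_right _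

/-- Powers beyond the r-th start above degree r, so the sum may be lengthened; this lets several
coefficients share one range. -/
theorem coeff_formalExp_of_le {A : PowerSeries R} (hA : PowerSeries.coeff 0 A = 0) {r N : ℕ}
    (h : r ≤ N) : PowerSeries.coeff r (formalExp A) =
      ∑ n ∈ Finset.range (N + 1), ((n ! : ℂ)⁻¹) • PowerSeries.coeff r (A ^ n) := by
  unfold formalExp
  rw [PowerSeries.coeff_mk]
  refine Finset.sum_subset (Finset.range_mono (by omega)) fun n _ hn => ?_
  rw [coeff_pow_eq_zero A hA n r (by simpa using hn), smul_zero]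

theorem coeff_zero_formalExp (A : PowerSeries R) : PowerSeries.coeff 0 (formalExp A) = 1 := by
  simp [formalExp]

theorem inv_factorial_succ (n : ℕ) : (((n + 1)! : ℕ) : ℂ)⁻¹ * ((n + 1 : ℕ) : ℂ) = (n ! : ℂ)⁻¹ := by
  have h1 : ((n + 1 : ℕ) : ℂ) ≠ 0 := by exact_mod_cast n.succ_ne_zero
  rw [Nat.factorial_succ, Nat.cast_mul, mul_inv, mul_right_comm, inv_mul_cancel₀ h1, one_mul]

/-- Termwise differentiation; commutation of A with its derivative makes the power rule valid.
Identities between exponentials thereby become recursions on coefficients. -/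
theorem euler_formalExp {A : PowerSeries R} (hA : PowerSeries.coeff 0 A = 0)
    (hc : Commute A (euler A)) : euler (formalExp A) = euler A * formalExp A := by
  ext r
  -- One superfluous power is kept, so that dropping n = 0 and shifting the index leaves the same
  -- range on both sides.
  rw [coeff_euler, PowerSeries.coeff_mul, coeff_formalExp_of_le hA (Nat.le_succ r),
    Finset.sum_range_succ', smul_add]
  have h0 : r • ((0 ! : ℂ)⁻¹ • PowerSeries.coeff r (A ^ 0)) = 0 := by
    rw [pow_zero, PowerSeries.coeff_one]
    split_ifs with h <;> simp [h]
  have h1 : ∀ x ∈ Finset.HasAntidiagonal.antidiagonal r, PowerSeries.coeff x.1 (euler A) *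
      PowerSeries.coeff x.2 (formalExp A) = ∑ n ∈ Finset.range (r + 1), ((n ! : ℂ)⁻¹) •
        (PowerSeries.coeff x.1 (euler A) * PowerSeries.coeff x.2 (A ^ n)) := by
    intro x hx
    rw [coeff_formalExp_of_le hA (Finset.HasAntidiagonal.antidiagonal.snd_le hx), Finset.mul_sum]
    simp only [mul_smul_comm]
  rw [h0, add_zero, Finset.sum_congr rfl h1, Finset.sum_comm, Finset.smul_sum]
  refine Finset.sum_congr rfl fun n _ => ?_
  rw [← Finset.smul_sum, ← PowerSeries.coeff_mul, smul_comm, ← coeff_euler, euler_pow_succ A hc,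
    map_nsmul, ← Nat.cast_smul_eq_nsmul ℂ, smul_smul, inv_factorial_succ]

end formalExp

theorem derivation_coeff_pow_succ {S : Type*} [CommRing S] [Algebra ℂ S] (d : Derivation ℂ S S)
    (A : PowerSeries S) (n r : ℕ) : d (PowerSeries.coeff r (A ^ (n + 1))) =
      (n + 1) • PowerSeries.coeff r (A ^ n * PowerSeries.mk fun i => d (PowerSeries.coeff i A)) := by
  have hmul : ∀ F G : PowerSeries S, (PowerSeries.mk fun i => d (PowerSeries.coeff i (F * G))) =
      F * (PowerSeries.mk fun i => d (PowerSeries.coeff i G)) +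
        G * (PowerSeries.mk fun i => d (PowerSeries.coeff i F)) := by
    intro F G
    rw [mul_comm G]
    ext r
    simp only [PowerSeries.coeff_mk, PowerSeries.coeff_mul, map_sum, map_add, Derivation.leibniz,
      Finset.sum_add_distrib, smul_eq_mul]
    congr 1
    exact Finset.sum_congr rfl fun x _ => mul_comm _ _
  have key : (PowerSeries.mk fun i => d (PowerSeries.coeff i (A ^ (n + 1)))) =
      (n + 1) • (A ^ n * PowerSeries.mk fun i => d (PowerSeries.coeff i A)) := by
    induction n with
    | zero => simp
    | succ n ih =>
      rw [pow_succ A (n + 1), hmul, ih, mul_smul_comm, ← mul_assoc, ← pow_succ', ← succ_nsmul']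
  rw [← map_nsmul, ← key, PowerSeries.coeff_mk]

/-- If the derivation `d` maps `A` to `c tᵐ` then it maps `exp A` to `c tᵐ exp A`. -/
theorem derivation_coeff_formalExp {S : Type*} [CommRing S] [Algebra ℂ S] (d : Derivation ℂ S S)
    {A : PowerSeries S} (hA : PowerSeries.coeff 0 A = 0) {m : ℕ} {c : S}
    (hd : (PowerSeries.mk fun i => d (PowerSeries.coeff i A)) =
      PowerSeries.C c * PowerSeries.X ^ m) (r : ℕ) :
    d (PowerSeries.coeff r (formalExp A)) =
      if m ≤ r then c * PowerSeries.coeff (r - m) (formalExp A) else 0 := by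
  rw [coeff_formalExp_of_le hA (Nat.le_succ r), Finset.sum_range_succ', map_add]
  have h0 : d ((0 ! : ℂ)⁻¹ • PowerSeries.coeff r (A ^ 0)) = 0 := by
    rw [pow_zero, PowerSeries.coeff_one]
    split_ifs <;> simp
  rw [h0, add_zero, map_sum]
  have h1 : ∀ n ∈ Finset.range (r + 1), d ((((n + 1)! : ℕ) : ℂ)⁻¹ •
      PowerSeries.coeff r (A ^ (n + 1))) =
        if m ≤ r then c * ((n ! : ℂ)⁻¹ • PowerSeries.coeff (r - m) (A ^ n)) else 0 := by
    intro n _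
    rw [Derivation.map_smul, derivation_coeff_pow_succ, hd, ← Nat.cast_smul_eq_nsmul ℂ, smul_smul,
      inv_factorial_succ, mul_left_comm, PowerSeries.coeff_C_mul, PowerSeries.coeff_mul_X_pow']
    split_ifs
    · rw [mul_smul_comm]
    · simp
  rw [Finset.sum_congr rfl h1]
  split_ifs
  · rw [← Finset.mul_sum, ← coeff_formalExp_of_le hA (Nat.sub_le r m)]
  · simp

/-! ### The polynomials q_n -/

theorem coeff_zero_creationExponent : PowerSeries.coeff 0 creationExponent = 0 := by
  simp [creationExponent]

theorem coeff_zero_annihilationExponent : PowerSeries.coeff 0 annihilationExponent = 0 := by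
  simp [annihilationExponent]

/-- The polynomials `q_n`, with `∑ q_n tⁿ = exp (∑_{m odd} (2 / m) p_m tᵐ)`. -/
def qPoly (n : ℕ) : OddSym := PowerSeries.coeff n (formalExp creationExponent)

/-- Coefficientwise form of ∂q(t)/∂p_m = (2/m) t^m q(t). -/
theorem pderiv_qPoly (m : {k : ℕ // Odd k}) (r : ℕ) :
    MvPolynomial.pderiv (R := ℂ) m (qPoly r) =
      if (m : ℕ) ≤ r then (2 / (m : ℕ) : ℂ) • qPoly (r - m) else 0 := by
  unfold qPoly
  rw [derivation_coeff_formalExp (MvPolynomial.pderiv (R := ℂ) m) coeff_zero_creationExponent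
    (m := (m : ℕ)) (c := MvPolynomial.C (2 / (m : ℕ) : ℂ)), MvPolynomial.C_mul']
  ext1 i
  rw [PowerSeries.coeff_mk, PowerSeries.coeff_C_mul, PowerSeries.coeff_X_pow, creationExponent,
    PowerSeries.coeff_mk]
  by_cases h : i = m
  · subst h
    simp [m.2]
  · rw [if_neg h, mul_zero]
    split_ifs with h'
    · rw [MvPolynomial.pderiv_C_mul, MvPolynomial.pderiv_X_of_ne, mul_zero]
      intro h2
      exact h (by rw [← h2])
    · simp

/-- `q(-t) q(t) = 1`. -/
theorem sum_antidiagonal_qPoly {n : ℕ} (hn : n ≠ 0) :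
    ∑ x ∈ Finset.HasAntidiagonal.antidiagonal n, (-1 : OddSym) ^ x.1 * (qPoly x.1 * qPoly x.2) = 0 := by
  set A := creationExponent with hA
  have hE := euler_formalExp coeff_zero_creationExponent (Commute.all A (euler A))
  have hr : ∀ F : PowerSeries OddSym, euler (PowerSeries.rescale (-1) F) =
      PowerSeries.rescale (-1) (euler F) := by
    intro F
    ext1 i
    simp only [coeff_euler, PowerSeries.coeff_rescale, mul_smul_comm]
  have hodd : PowerSeries.rescale (-1) (euler A) = -euler A := by
    ext1 i
    rw [map_neg, coeff_euler, PowerSeries.coeff_rescale, coeff_euler, hA, creationExponent,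
      PowerSeries.coeff_mk]
    split_ifs with h
    · rw [h.neg_one_pow, neg_one_mul]
    · simp
  -- The exponent is odd in t, so the logarithmic derivatives of q(-t) and q(t) cancel.
  have h0 : euler (PowerSeries.rescale (-1) (formalExp A) * formalExp A) = 0 := by
    rw [euler_mul, hr, hE, map_mul, hodd]
    ring
  have h1 := congrArg (PowerSeries.coeff n) h0
  rw [coeff_euler, map_zero, smul_eq_zero_iff_right hn, PowerSeries.coeff_mul] at h1
  rw [← h1]
  refine Finset.sum_congr rfl fun x _ => ?_
  rw [PowerSeries.coeff_rescale, mul_assoc]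
  rfl

/-! ### Commuting the two exponentials -/

theorem commute_coeff_annihilationExponent (i j : ℕ) :
    Commute (PowerSeries.coeff i annihilationExponent)
      (PowerSeries.coeff j annihilationExponent) := by
  have key : ∀ a b : {k : ℕ // Odd k},
      Commute (MvPolynomial.pderiv (R := ℂ) a).toLinearMap
        (MvPolynomial.pderiv (R := ℂ) b).toLinearMap := by
    intro a b
    -- The bracket is again a derivation, so it suffices that it kills the variables.
    have h : ⁅MvPolynomial.pderiv (R := ℂ) a, MvPolynomial.pderiv (R := ℂ) b⁆ = 0 := by
      refine MvPolynomial.derivation_ext fun k => ?_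
      rw [Derivation.commutator_apply, MvPolynomial.pderiv_X, MvPolynomial.pderiv_X]
      simp [Pi.single_apply, apply_ite]
    refine LinearMap.ext fun f => ?_
    have := congrArg (fun d : Derivation ℂ OddSym OddSym => d f) h
    simpa [Derivation.commutator_apply, sub_eq_zero] using this
  unfold annihilationExponent
  rw [PowerSeries.coeff_mk, PowerSeries.coeff_mk]
  split_ifs
  · exact ((key _ _).neg_left).neg_right
  · exact Commute.zero_right _
  · exact Commute.zero_left _
  · exact Commute.zero_left _

theorem commute_annihilationCoeff (i j : ℕ) :
    Commute (annihilationCoeff i) (annihilationCoeff j) :=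
  commute_coeff_formalExp (fun _ => (commute_coeff_formalExp
    (fun _ => commute_coeff_annihilationExponent _ _) _).symm) _

/-- `t d/dt` of the second exponential. -/
theorem nsmul_annihilationCoeff (s : ℕ) (f : OddSym) :
    s • annihilationCoeff s f = ∑ x ∈ Finset.HasAntidiagonal.antidiagonal s,
      x.1 • PowerSeries.coeff x.1 annihilationExponent (annihilationCoeff x.2 f) := by
  have h := congrArg (PowerSeries.coeff s) (euler_formalExp coeff_zero_annihilationExponent
    (commute_of_coeff fun i j => by
      rw [coeff_euler]
      exact (commute_coeff_annihilationExponent i j).smul_right j))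
  rw [coeff_euler, PowerSeries.coeff_mul] at h
  have h2 := LinearMap.congr_fun h f
  rw [LinearMap.smul_apply, LinearMap.sum_apply] at h2
  rw [annihilationCoeff, h2]
  refine Finset.sum_congr rfl fun x _ => ?_
  rw [coeff_euler]
  rfl

open Finset.HasAntidiagonal in
theorem sum_antidiagonal_assoc {M : Type*} [AddCommMonoid M] (n : ℕ) (f : ℕ → ℕ → ℕ → M) :
    ∑ x ∈ antidiagonal n, ∑ y ∈ antidiagonal x.2, f x.1 y.1 y.2 =
      ∑ x ∈ antidiagonal n, ∑ y ∈ antidiagonal x.1, f y.1 y.2 x.2 := by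
  rw [Finset.sum_sigma', Finset.sum_sigma']
  refine Finset.sum_nbij' (fun a => ⟨(a.1.1 + a.2.1, a.2.2), (a.1.1, a.2.1)⟩)
    (fun a => ⟨(a.2.1, a.2.2 + a.1.2), (a.2.2, a.1.2)⟩) ?_ ?_ ?_ ?_ ?_ <;>
  · rintro ⟨⟨a, b⟩, ⟨c, d⟩⟩
    simp only [Finset.mem_sigma, mem_antidiagonal]
    rintro ⟨rfl, rfl⟩
    simp [add_assoc]

open Finset.HasAntidiagonal in
theorem sum_antidiagonal_left_comm {M : Type*} [AddCommMonoid M] (n : ℕ) (f : ℕ → ℕ → ℕ → M) :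
    ∑ x ∈ antidiagonal n, ∑ y ∈ antidiagonal x.2, f x.1 y.1 y.2 =
      ∑ x ∈ antidiagonal n, ∑ y ∈ antidiagonal x.2, f y.1 x.1 y.2 := by
  rw [sum_antidiagonal_assoc, sum_antidiagonal_assoc n fun a b c => f b a c]
  refine Finset.sum_congr rfl fun x _ => ?_
  rw [← Finset.Nat.sum_antidiagonal_swap]
  rfl

/-- The coefficient of `xᵏ` in `(1 - x) / (1 + x)`. -/
def contractionCoeff (k : ℕ) : ℂ := if k = 0 then 1 else 2 * (-1) ^ k

/-- For c(x) = (1 - x)/(1 + x) this is x c'(x) = -2(x + x³ + x⁵ + ⋯) c(x), read off at x^l. The odd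
indicator has period 2, hence the two-step induction. -/
theorem sum_antidiagonal_odd_contractionCoeff (l : ℕ) :
    -2 * ∑ x ∈ Finset.HasAntidiagonal.antidiagonal l,
      (if Odd x.1 then contractionCoeff x.2 else 0) = l * contractionCoeff l := by
  induction l using Nat.twoStepInduction with
  | zero => simp
  | one => simp [Finset.Nat.antidiagonal_succ, contractionCoeff]
  | more l ih _ =>
    have h : ∀ x : ℕ × ℕ, (if Odd (x.1 + 1 + 1) then contractionCoeff x.2 else 0) =
        if Odd x.1 then contractionCoeff x.2 else 0 := by
      intro x
      simp [add_assoc, Nat.odd_add, parity_simps]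
    rw [Finset.Nat.sum_antidiagonal_succ, Finset.Nat.sum_antidiagonal_succ]
    simp only [h, mul_add, ih]
    rcases l with _ | l
    · norm_num [contractionCoeff]
    · simp [contractionCoeff]
      ring

/-- `q_{r-k}`, which is `0` for `k > r`. -/
def qShift (r k : ℕ) : OddSym := if k ≤ r then qPoly (r - k) else 0

theorem nsmul_annihilationExponent_qShift_mul (i r k : ℕ) (h : OddSym) :
    i • PowerSeries.coeff i annihilationExponent (qShift r k * h) =
      (if Odd i then -2 * (qShift r (k + i) * h) else 0) +
        qShift r k * (i • PowerSeries.coeff i annihilationExponent h) := by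
  unfold annihilationExponent
  rw [PowerSeries.coeff_mk]
  split_ifs with hi
  · have h1 : i • MvPolynomial.pderiv (R := ℂ) (⟨i, hi⟩ : {k : ℕ // Odd k}) (qShift r k) =
        2 * qShift r (k + i) := by
      unfold qShift
      by_cases h2 : k + i ≤ r
      · have hi0 : (i : ℂ) ≠ 0 := by exact_mod_cast hi.pos.ne'
        have h3 : (i : ℂ) * (2 / i) = 2 := by field_simp
        rw [if_pos (by omega), if_pos h2, pderiv_qPoly, if_pos (by simp; omega),
          ← Nat.cast_smul_eq_nsmul ℂ, smul_smul, Nat.sub_sub, h3, two_smul, two_mul]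
      · rw [if_neg h2, mul_zero]
        split_ifs with h4
        · rw [pderiv_qPoly, if_neg (by simp; omega), smul_zero]
        · simp
    simp only [LinearMap.neg_apply, Derivation.coeFn_coe, Derivation.leibniz, smul_eq_mul, smul_neg,
      smul_add, ← mul_smul_comm]
    rw [h1]
    ring
  · simp

/-- The commutation relation between the coefficients of the two exponentials:
`D(x) q(u) = (1 - x u) / (1 + x u) q(u) D(x)`. -/
theorem annihilationCoeff_qPoly_mul (s r : ℕ) (g : OddSym) :
    annihilationCoeff s (qPoly r * g) = ∑ x ∈ Finset.HasAntidiagonal.antidiagonal s,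
      contractionCoeff x.1 • (qShift r x.1 * annihilationCoeff x.2 g) := by
  induction s using Nat.strong_induction_on with
  | _ s ih =>
  rcases Nat.eq_zero_or_pos s with rfl | hs
  · have h : ∀ f, annihilationCoeff 0 f = f := fun f => by
      rw [annihilationCoeff, coeff_zero_formalExp]
      rfl
    simp [h, contractionCoeff, qShift]
  -- Both sides satisfy the same Euler recursion in s; s > 0 can be cancelled in characteristic 0.
  refine smul_right_injective OddSym hs.ne' ?_
  change s • _ = s • _
  rw [nsmul_annihilationCoeff]
  -- Leibniz rule: the first sum differentiates q_r, the second g. After regrouping they contribute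
  -- the factors `x.1` and `x.2`, which add up to s.
  have h1 : ∀ x ∈ Finset.HasAntidiagonal.antidiagonal s,
      x.1 • PowerSeries.coeff x.1 annihilationExponent (annihilationCoeff x.2 (qPoly r * g)) =
      ∑ y ∈ Finset.HasAntidiagonal.antidiagonal x.2,
        (if Odd x.1 then contractionCoeff y.1 else 0) •
          (-2 * (qShift r (x.1 + y.1) * annihilationCoeff y.2 g)) +
      ∑ y ∈ Finset.HasAntidiagonal.antidiagonal x.2,
        contractionCoeff y.1 • (qShift r y.1 *
          (x.1 • PowerSeries.coeff x.1 annihilationExponent (annihilationCoeff y.2 g))) := by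
    intro x hx
    rcases Nat.eq_zero_or_pos x.1 with h0 | h0
    · simp [h0]
    rw [ih x.2 (by have := Finset.HasAntidiagonal.mem_antidiagonal.mp hx; omega), map_sum,
      Finset.smul_sum, ← Finset.sum_add_distrib]
    refine Finset.sum_congr rfl fun y _ => ?_
    rw [map_smul, smul_comm, nsmul_annihilationExponent_qShift_mul, smul_add, add_comm y.1]
    split_ifs <;> simp
  rw [Finset.sum_congr rfl h1, Finset.sum_add_distrib,
    sum_antidiagonal_assoc s fun a b c => (if Odd a then contractionCoeff b else 0) •
      (-2 * (qShift r (a + b) * annihilationCoeff c g)),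
    sum_antidiagonal_left_comm s fun a b c => contractionCoeff b • (qShift r b *
      (a • PowerSeries.coeff a annihilationExponent (annihilationCoeff c g))),
    ← Finset.sum_add_distrib, Finset.smul_sum]
  refine Finset.sum_congr rfl fun x hx => ?_
  have h2 : ∑ y ∈ Finset.HasAntidiagonal.antidiagonal x.1,
      (if Odd y.1 then contractionCoeff y.2 else 0) •
        (-2 * (qShift r (y.1 + y.2) * annihilationCoeff x.2 g)) =
      x.1 • (contractionCoeff x.1 • (qShift r x.1 * annihilationCoeff x.2 g)) := by
    have h3 : ∀ f : OddSym, -2 * f = (-2 : ℂ) • f := fun f => by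
      rw [neg_mul, neg_smul, two_mul, two_smul]
    rw [← Nat.cast_smul_eq_nsmul ℂ, smul_smul, ← sum_antidiagonal_odd_contractionCoeff,
      mul_comm, ← smul_smul, ← h3, Finset.sum_smul]
    refine Finset.sum_congr rfl fun y hy => ?_
    rw [Finset.HasAntidiagonal.mem_antidiagonal.mp hy]
  rw [h2, ← Finset.smul_sum, ← Finset.mul_sum, ← nsmul_annihilationCoeff, mul_smul_comm,
    smul_comm _ x.2, ← add_smul, Finset.HasAntidiagonal.mem_antidiagonal.mp hx]

/-! ### Products of two operators and anticommutation -/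

theorem Y_neg_apply {f : OddSym} {M : ℕ} (hM : ∀ s, M ≤ s → annihilationCoeff s f = 0) (a : ℕ) :
    Y (-(a : ℤ)) f = ∑ s ∈ Finset.range M, qPoly (a + s) * annihilationCoeff s f := by
  have h : ∀ s : ℕ, creationCoeff (s - -(a : ℤ)) = qPoly (a + s) := by
    intro s
    rw [creationCoeff, if_pos (by omega), qPoly]
    congr 2
    omega
  change ∑ᶠ s : ℕ, creationCoeff (s - -(a : ℤ)) * annihilationCoeff s f = _
  simp only [h]
  refine finsum_eq_sum_of_support_subset _ fun s hs => ?_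
  by_contra hlt
  exact hs (by simp only [hM s (by simpa using hlt), mul_zero])

theorem exists_annihilationCoeff_eq_zero (f : OddSym) :
    ∃ N, ∀ s, N ≤ s → annihilationCoeff s f = 0 := by
  obtain ⟨N, hN⟩ := (annihilationCoeff_finite f).bddAbove
  exact ⟨N + 1, fun s hs => by_contra fun h => by have := hN h; omega⟩

/-- The triangle of pairs with sum below L contains the K × N rectangle outside which g vanishes. -/
theorem sum_range_sum_antidiagonal {M : Type*} [AddCommMonoid M] {K N L : ℕ} (hL : K + N ≤ L)
    (g : ℕ × ℕ → M) (hK : ∀ x, K ≤ x.1 → g x = 0) (hN : ∀ x, N ≤ x.2 → g x = 0) :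
    ∑ s ∈ Finset.range L, ∑ x ∈ Finset.HasAntidiagonal.antidiagonal s, g x =
      ∑ p ∈ Finset.range N, ∑ k ∈ Finset.range K, g (k, p) := by
  rw [Finset.sum_comm, ← Finset.sum_product' (Finset.range K) (Finset.range N) fun k p => g (k, p),
    ← Finset.sum_fiberwise_of_maps_to (t := Finset.range L) (g := fun x : ℕ × ℕ => x.1 + x.2)]
  · refine Finset.sum_congr rfl fun s _ => (Finset.sum_subset ?_ ?_).symm
    · intro x hx
      exact Finset.HasAntidiagonal.mem_antidiagonal.mpr (Finset.mem_filter.mp hx).2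
    · intro x hx hx'
      by_contra h
      refine hx' (Finset.mem_filter.mpr ⟨Finset.mem_product.mpr ⟨?_, ?_⟩,
        Finset.HasAntidiagonal.mem_antidiagonal.mp hx⟩)
      · exact Finset.mem_range.mpr (not_le.mp fun h' => h (hK x h'))
      · exact Finset.mem_range.mpr (not_le.mp fun h' => h (hN x h'))
  · intro x hx
    simp only [Finset.mem_product, Finset.mem_range] at hx ⊢
    omega

/-- The coefficient of `tˣ uʸ` in `(t - u) / (t + u) q(t) q(u)`, expanded in powers of `u / t`. -/
def pairCoeff (x y : ℕ) : OddSym :=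
  ∑ k ∈ Finset.range (y + 1), contractionCoeff k • (qPoly (x + k) * qPoly (y - k))

theorem sum_range_qShift {y K : ℕ} (hK : y < K) (x : ℕ) :
    ∑ k ∈ Finset.range K, contractionCoeff k • (qPoly (x + k) * qShift y k) = pairCoeff x y := by
  unfold pairCoeff
  rw [← Finset.sum_subset (Finset.range_mono hK)]
  · refine Finset.sum_congr rfl fun k hk => ?_
    rw [qShift, if_pos (by simpa [Nat.lt_succ_iff] using hk)]
  · intro k _ hk
    rw [qShift, if_neg (by simpa [Nat.lt_succ_iff] using hk), mul_zero, smul_zero]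

theorem Y_neg_mul_apply {f : OddSym} {N : ℕ} (hN : ∀ s, N ≤ s → annihilationCoeff s f = 0)
    (a b : ℕ) : (Y (-(a : ℤ)) * Y (-(b : ℤ))) f =
      ∑ i ∈ Finset.range N, ∑ p ∈ Finset.range N,
        pairCoeff (a + p) (b + i) * annihilationCoeff p (annihilationCoeff i f) := by
  have hN' : ∀ i s, N ≤ s → annihilationCoeff s (annihilationCoeff i f) = 0 := by
    intro i s hs
    rw [← Module.End.mul_apply, (commute_annihilationCoeff s i).eq, Module.End.mul_apply, hN s hs,
      map_zero]
  obtain ⟨L₀, hL₀⟩ := exists_annihilationCoeff_eq_zero (Y (-(b : ℤ)) f)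
  -- The bound is enlarged to cover every k + p with k < b + N (beyond which `qShift` vanishes) and
  -- p < N.
  have hL : ∀ s, L₀ + (b + N + N) ≤ s → annihilationCoeff s (Y (-(b : ℤ)) f) = 0 :=
    fun s hs => hL₀ s (by omega)
  rw [Module.End.mul_apply, Y_neg_apply hL, Y_neg_apply hN]
  simp only [map_sum, Finset.mul_sum]
  rw [Finset.sum_comm]
  refine Finset.sum_congr rfl fun i hi => ?_
  have hi' := Finset.mem_range.mp hi
  have h1 : ∀ s ∈ Finset.range (L₀ + (b + N + N)),
      qPoly (a + s) * annihilationCoeff s (qPoly (b + i) * annihilationCoeff i f) =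
        ∑ x ∈ Finset.HasAntidiagonal.antidiagonal s, (contractionCoeff x.1 •
          (qPoly (a + x.2 + x.1) * qShift (b + i) x.1)) *
            annihilationCoeff x.2 (annihilationCoeff i f) := by
    intro s _
    rw [annihilationCoeff_qPoly_mul, Finset.mul_sum]
    refine Finset.sum_congr rfl fun x hx => ?_
    rw [← Finset.HasAntidiagonal.mem_antidiagonal.mp hx, mul_smul_comm, smul_mul_assoc, mul_assoc,
      add_right_comm, add_assoc]
  rw [Finset.sum_congr rfl h1, sum_range_sum_antidiagonal (K := b + N) (N := N) (by omega)]
  · refine Finset.sum_congr rfl fun p _ => ?_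
    dsimp only
    rw [← Finset.sum_mul, sum_range_qShift (by omega)]
  · intro x hx
    rw [qShift, if_neg (by omega), mul_zero, smul_zero, zero_mul]
  · intro x hx
    rw [hN' i x.2 hx, mul_zero]

theorem pairCoeff_add_pairCoeff {x y : ℕ} (h : x + y ≠ 0) : pairCoeff x y + pairCoeff y x = 0 := by
  have hc : ∀ y, ∀ k ∈ Finset.range y, contractionCoeff (k + 1) = 2 * (-1 : ℂ) ^ (k + 1) :=
    fun y k _ => by simp [contractionCoeff]
  have hexp : ∀ x y, pairCoeff x y = (∑ k ∈ Finset.range y,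
      (2 * (-1 : ℂ) ^ (k + 1)) • (qPoly (x + (k + 1)) * qPoly (y - (k + 1)))) +
        qPoly x * qPoly y := by
    intro x y
    rw [pairCoeff, Finset.sum_range_succ']
    rw [Finset.sum_congr rfl fun k hk => by rw [hc y k hk]]
    simp [contractionCoeff]
  have hq := sum_antidiagonal_qPoly h
  -- Cut the relation q(-t)q(t) = 1 in degree x + y at index x: up to the factor 2(-1)^x, the terms
  -- below x give the tail of `pairCoeff y x`, those above x the tail of `pairCoeff x y`, and the
  -- middle one supplies both leading terms.
  rw [Finset.Nat.sum_antidiagonal_eq_sum_range_succ_mk,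
    show (x + y).succ = x + (y + 1) by omega, Finset.sum_range_add, Finset.sum_range_succ'] at hq
  have h1 : pairCoeff y x = (2 * (-1 : ℂ) ^ x) • ∑ j ∈ Finset.range x,
      (-1 : OddSym) ^ j * (qPoly j * qPoly (x + y - j)) + qPoly x * qPoly y := by
    rw [hexp, mul_comm (qPoly y), ← Finset.sum_range_reflect, Finset.smul_sum]
    congr 1
    refine Finset.sum_congr rfl fun j hj => ?_
    have hj' := Finset.mem_range.mp hj
    have e1 : x - 1 - j + 1 = x - j := by omega
    have e2 : y + (x - j) = x + y - j := by omega
    have e3 : x - (x - j) = j := by omega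
    have e4 : (-1 : ℂ) ^ (x - j) = (-1) ^ x * (-1) ^ j := by
      rw [← pow_add, show x + j = (x - j) + 2 * j by omega, pow_add, pow_mul]
      simp
    have e5 : ((-1 : OddSym)) ^ j = MvPolynomial.C ((-1 : ℂ) ^ j) := by simp
    rw [e1, e2, e3, e4, e5, MvPolynomial.C_mul', smul_smul, mul_comm (qPoly j), mul_assoc]
  have h2 : pairCoeff x y = (2 * (-1 : ℂ) ^ x) • ∑ k ∈ Finset.range y,
      (-1 : OddSym) ^ (x + (k + 1)) * (qPoly (x + (k + 1)) * qPoly (x + y - (x + (k + 1)))) +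
        qPoly x * qPoly y := by
    rw [hexp, Finset.smul_sum]
    congr 1
    refine Finset.sum_congr rfl fun k _ => ?_
    have e5 : ((-1 : OddSym)) ^ (x + (k + 1)) = MvPolynomial.C ((-1 : ℂ) ^ (x + (k + 1))) := by simp
    have e4 : (-1 : ℂ) ^ x * (-1) ^ x = 1 := by rw [← mul_pow]; simp
    rw [e5, MvPolynomial.C_mul', smul_smul, Nat.add_sub_add_left, pow_add _ x,
      mul_assoc, ← mul_assoc (_ ^ x), e4, one_mul]
  have h3 : (2 * (-1 : ℂ) ^ x) • ((-1 : OddSym) ^ (x + 0) *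
      (qPoly (x + 0) * qPoly (x + y - (x + 0)))) = 2 * (qPoly x * qPoly y) := by
    have e5 : ((-1 : OddSym)) ^ x = MvPolynomial.C ((-1 : ℂ) ^ x) := by simp
    have e4 : (-1 : ℂ) ^ x * (-1) ^ x = 1 := by rw [← mul_pow]; simp
    rw [add_zero, Nat.add_sub_cancel_left, e5, MvPolynomial.C_mul', smul_smul, mul_assoc, e4,
      mul_one, two_smul, two_mul]
  have h4 := congrArg (fun f => (2 * (-1 : ℂ) ^ x) • f) hq
  simp only [smul_add, smul_zero] at h4
  rw [h3] at h4
  rw [h1, h2, ← h4]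
  ring

/-- The anticommutation relation of the operators `Y_{-a}` with `a ≥ 0`. -/
theorem Y_neg_mul_add_mul {a b : ℕ} (h : a + b ≠ 0) :
    Y (-(a : ℤ)) * Y (-(b : ℤ)) + Y (-(b : ℤ)) * Y (-(a : ℤ)) = 0 := by
  refine LinearMap.ext fun f => ?_
  obtain ⟨N, hN⟩ := exists_annihilationCoeff_eq_zero f
  rw [LinearMap.add_apply, Y_neg_mul_apply hN, Y_neg_mul_apply hN b a,
    Finset.sum_comm (f := fun i p => pairCoeff (b + p) (a + i) * _), ← Finset.sum_add_distrib]
  refine Finset.sum_eq_zero fun i _ => ?_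
  rw [← Finset.sum_add_distrib]
  refine Finset.sum_eq_zero fun p _ => ?_
  rw [← Module.End.mul_apply (annihilationCoeff i), (commute_annihilationCoeff i p).eq,
    Module.End.mul_apply, ← add_mul, pairCoeff_add_pairCoeff (by omega), zero_mul]

theorem Y_neg_mul_self {a : ℕ} (h : a ≠ 0) : Y (-(a : ℤ)) * Y (-(a : ℤ)) = 0 := by
  have h1 := Y_neg_mul_add_mul (a := a) (b := a) (by omega)
  rw [← two_smul ℂ] at h1
  exact (smul_eq_zero.mp h1).resolve_left two_ne_zero

/-! ### Reordering words -/

theorem YNeg_cons (a : ℕ) (l : List ℕ) : YNeg (a :: l) = Y (-(a : ℤ)) * YNeg l := by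
  simp [YNeg]

/-- Each adjacent swap changes the sign. The bound on zeros excludes swapping two zeros, where
anticommutation fails. -/
theorem YNeg_perm {l l' : List ℕ} (h : l.Perm l') (h0 : l.count 0 ≤ 1) :
    YNeg l = YNeg l' ∨ YNeg l = -YNeg l' := by
  induction h with
  | nil => exact Or.inl rfl
  | cons a _ ih =>
    rw [YNeg_cons, YNeg_cons]
    rcases ih ((List.count_le_count_cons).trans h0) with h | h
    · exact Or.inl (by rw [h])
    · exact Or.inr (by rw [h]; exact LinearMap.ext fun f => map_neg (Y (-(a : ℤ))) _)
  | swap a b l =>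
    right
    have hab : b + a ≠ 0 := by
      intro h
      obtain ⟨rfl, rfl⟩ : b = 0 ∧ a = 0 := by omega
      simp at h0
    rw [YNeg_cons, YNeg_cons, YNeg_cons, YNeg_cons, ← mul_assoc, ← mul_assoc,
      eq_neg_of_add_eq_zero_left (Y_neg_mul_add_mul hab)]
    rfl
  | trans h₁ _ ih₁ ih₂ =>
    rw [h₁.count_eq] at ih₁
    have h0' := h0
    rw [h₁.count_eq] at h0'
    rcases ih₁ h0' with h | h <;> rcases ih₂ h0' with h' | h' <;> rw [h, h'] <;> simp

/-- A repeated entry must be positive; two copies moved to the front give a vanishing square. -/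
theorem YNeg_eq_zero {l : List ℕ} (h0 : l.count 0 ≤ 1) (hl : ¬ l.Nodup) : YNeg l = 0 := by
  obtain ⟨a, ha⟩ := List.exists_duplicate_iff_not_nodup.mpr hl
  have h2 := List.duplicate_iff_two_le_count.mp ha
  have ha0 : a ≠ 0 := by
    rintro rfl
    omega
  have hp : l.Perm (a :: a :: (l.erase a).erase a) := by
    refine (List.perm_cons_erase ha.mem).trans (List.Perm.cons _ (List.perm_cons_erase ?_))
    rw [← List.count_pos_iff, List.count_erase_self]
    omega
  have h3 : YNeg (a :: a :: (l.erase a).erase a) = 0 := by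
    rw [YNeg_cons, YNeg_cons, ← mul_assoc, Y_neg_mul_self ha0, zero_mul]
  rcases YNeg_perm hp h0 with h | h <;> rw [h, h3]
  exact neg_zero

end SchurQ

end

theorem corollary6p5 (m : ℕ) (μ : List ℕ) (hμ : μ.sum = m) (hzero : μ.count 0 ≤ 1) :
    SchurQ.YNeg μ = 0 ∨
      ∃ lam : List ℕ, SchurQ.IsStrictPartition lam m ∧ lam.length = μ.length ∧
        (0 ∈ lam → 0 ∈ μ) ∧
        (SchurQ.YNeg μ = SchurQ.YNeg lam ∨ SchurQ.YNeg μ = -SchurQ.YNeg lam) := by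
  by_cases hd : μ.Nodup
  · have hp := List.perm_insertionSort (· ≥ ·) μ
    refine Or.inr ⟨μ.insertionSort (· ≥ ·), ⟨?_, hp.sum_eq.trans hμ⟩, hp.length_eq, hp.mem_iff.mp,
      SchurQ.YNeg_perm hp.symm hzero⟩
    -- Weakly decreasing without repetition is strictly decreasing.
    exact ((List.pairwise_insertionSort (· ≥ ·) μ).and (hp.nodup_iff.mpr hd)).imp
      fun h => lt_of_le_of_ne h.1 h.2.symm
  · exact Or.inl (SchurQ.YNeg_eq_zero hzero hd)
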